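/- Order the monomials of $\mathbb{C}[x_1,\dots,x_n]$ by the graded reverse lexicographic order with $x_1\succ x_2\succ\dots\succ x_n$: $x^a\prec x^b$ if and only if $\deg x^a<\deg x^b$, or $\deg x^a=\deg x^b$ and the last non-zero entry of $b-a$ is negative. Write $\mathrm{in}(f)$ for the leading term of a polynomial $f$ and $\mathrm{in}(I)$ for the ideal generated by the leading terms of the elements of an ideal $I$. For $g\in GL_n(\mathbb{C})$ let $g\cdot I$ be the image of $I$ under the linear change of coordinates $x_i\mapsto\sum_j g_{ij}x_j$. For a homogeneous ideal $I$, the generic initial ideal $\mathrm{gin}(I)$ is the common value of $\mathrm{in}(g\cdot I)$ for all $g$ in a suitable non-empty Zariski open subset of $GL_n(\mathbb{C})$. Let $K$ be a homogeneous ideal in $\mathbb{C}[x_1,x_2,x_3]$ and let $k\ge 1$ be the largest integer $j\geq 0$ with $\mathrm{gin}(K)\subseteq(x_1^j)$ (in particular, a largest such $j$ is assumed to exist). Then, after a generic linear change of coordinates, there is a homogeneous polynomial $X$ such that $\mathrm{in}(X)=x_1^k$ and $K=X\cdot K'$ for some homogeneous ideal $K'$. That is: for all $g$ in a non-empty Zariski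 open subset of $GL_3(\mathbb{C})$ there are a homogeneous polynomial $X$ of degree $k$ with $\mathrm{in}(X)=x_1^k$ and a homogeneous ideal $K'\subseteq\mathbb{C}[x_1,x_2,x_3]$ with $g\cdot K=X\cdot K'$. -/

import Mathlib

open MvPolynomial

attribute [local instance] MvPolynomial.gradedAlgebra

/-! ### The (graded) reverse lexicographic order -/

/-- Exponent vectors in `n` variables, as a type to be ordered by the graded reverse
lexicographic order. -/
def DegRevLex (n : ℕ) : Type := Fin n →₀ ℕ

namespace DegRevLex

variable {n : ℕ}

noncomputable instance : AddCommMonoid (DegRevLex n) :=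
  inferInstanceAs (AddCommMonoid (Fin n →₀ ℕ))

/-- The identity map from exponent vectors. -/
noncomputable def of (n : ℕ) : (Fin n →₀ ℕ) ≃+ DegRevLex n := AddEquiv.refl _

/-- The comparison key: first the total degree, then the exponents of the variables,
the last variable first, where a smaller exponent means a larger monomial. -/
noncomputable def key (a : DegRevLex n) : ℕ ×ₗ Lex (Fin n → ℕᵒᵈ) :=
  toLex (((of n).symm a).degree, toLex fun i => OrderDual.toDual ((of n).symm a i.rev))

theorem key_injective : Function.Injective (key (n := n)) := by
  intro a b h
  have h2 : (fun i : Fin n => OrderDual.toDual ((of n).symm a i.rev))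
      = fun i : Fin n => OrderDual.toDual ((of n).symm b i.rev) :=
    congrArg (fun z : ℕ ×ₗ Lex (Fin n → ℕᵒᵈ) => ofLex (ofLex z).2) h
  apply (of n).symm.injective
  ext i
  have h3 := congrFun h2 i.rev
  simpa using h3

noncomputable instance : LinearOrder (DegRevLex n) := LinearOrder.lift' key key_injective

theorem lt_iff {a b : Fin n →₀ ℕ} :
    of n a < of n b ↔ a.degree < b.degree ∨
      (a.degree = b.degree ∧ ∃ i, (∀ j, i < j → a j = b j) ∧ b i < a i) := by
  have h : of n a < of n b ↔ key (of n a) < key (of n b) := Iff.rfl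
  rw [h, key, key, Prod.Lex.toLex_lt_toLex]
  simp only [AddEquiv.symm_apply_apply]
  refine or_congr Iff.rfl (and_congr Iff.rfl ?_)
  constructor
  · rintro ⟨i, hi, hlt⟩
    refine ⟨i.rev, fun j hj => ?_, hlt⟩
    have := hi j.rev (show j.rev < i by rwa [Fin.rev_lt_iff])
    simpa using this
  · rintro ⟨i, hi, hlt⟩
    refine ⟨i.rev, fun j hj => ?_, ?_⟩
    · have := hi j.rev (by rwa [Fin.lt_rev_iff])
      exact congrArg OrderDual.toDual this
    · change OrderDual.toDual (a i.rev.rev) < OrderDual.toDual (b i.rev.rev)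
      simpa using hlt

theorem add_lt_add_left' {a b : Fin n →₀ ℕ} (h : of n a < of n b) (c : Fin n →₀ ℕ) :
    of n (a + c) < of n (b + c) := by
  rw [lt_iff] at h ⊢
  simp only [map_add, Finsupp.add_apply]
  rcases h with h | ⟨h, i, hi, hlt⟩
  · exact Or.inl (by omega)
  · exact Or.inr ⟨by omega, i, fun j hj => by rw [hi j hj], by omega⟩

instance : IsOrderedAddMonoid (DegRevLex n) where
  add_le_add_left a b h c := by
    rcases h.eq_or_lt with rfl | h
    · exact le_rfl
    · exact (add_lt_add_left' (a := (of n).symm a) (b := (of n).symm b) h ((of n).symm c)).le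

theorem of_monotone : Monotone (of n) := by
  intro a b h
  obtain ⟨c, rfl⟩ := le_iff_exists_add.mp h
  rcases eq_or_ne c 0 with rfl | hc
  · simp
  · refine (lt_iff.mpr (Or.inl ?_)).le
    have : c.degree ≠ 0 := fun h0 => hc ((Finsupp.degree_eq_zero_iff c).mp h0)
    rw [map_add]
    omega

instance : WellFoundedLT (DegRevLex n) where
  wf := by
    have hw : WellQuasiOrdered ((· ≤ ·) : DegRevLex n → DegRevLex n → Prop) := by
      intro f
      obtain ⟨i, j, hij, h⟩ := wellQuasiOrdered_le (fun k => (of n).symm (f k))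
      exact ⟨i, j, hij, of_monotone h⟩
    simpa only [lt_iff_le_not_ge] using hw.wellFounded

end DegRevLex

/-- The graded reverse lexicographic order on the monomials in `x₁ ≻ x₂ ≻ ⋯ ≻ xₙ`
(the variable `x_{i+1}` is `X i`). -/
noncomputable def degRevLex (n : ℕ) : MonomialOrder (Fin n) where
  syn := DegRevLex n
  toSyn := DegRevLex.of n
  toSyn_monotone := DegRevLex.of_monotone

/-- `x^a ≺ x^b` iff `deg a < deg b`, or the degrees agree and the last nonzero entry of
`b - a` is negative. -/
theorem degRevLex_lt_iff {n : ℕ} {a b : Fin n →₀ ℕ} :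
    (degRevLex n).toSyn a < (degRevLex n).toSyn b ↔ a.degree < b.degree ∨
      (a.degree = b.degree ∧ ∃ i, (∀ j, i < j → a j = b j) ∧ b i < a i) :=
  DegRevLex.lt_iff

/-! ### Initial ideals, generic coordinates, generic initial ideals -/

/-- The initial ideal `in(I)`: generated by the leading terms of the elements of `I`. -/
noncomputable def initialIdeal {n : ℕ} (I : Ideal (MvPolynomial (Fin n) ℂ)) :
    Ideal (MvPolynomial (Fin n) ℂ) :=
  Ideal.span ((degRevLex n).leadingTerm '' (I : Set (MvPolynomial (Fin n) ℂ)))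

/-- The linear change of coordinates `x_i ↦ ∑ j, g i j • x_j`. -/
noncomputable def coordChange {n : ℕ} (g : GL (Fin n) ℂ) :
    MvPolynomial (Fin n) ℂ →ₐ[ℂ] MvPolynomial (Fin n) ℂ :=
  aeval fun i => ∑ j, C (g i j) * X j

/-- The ideal `g · I`: the ideal `I` written in the coordinates given by `g`. -/
noncomputable def changeCoords {n : ℕ} (g : GL (Fin n) ℂ) (I : Ideal (MvPolynomial (Fin n) ℂ)) :
    Ideal (MvPolynomial (Fin n) ℂ) :=
  I.map (coordChange g)

/-- `p g` holds for generic `g ∈ GLₙ(ℂ)`: on the complement of the zero locus of some nonzero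
polynomial in the matrix entries, that is, on a nonempty Zariski open subset of `GLₙ(ℂ)`. -/
def Generically {n : ℕ} (p : GL (Fin n) ℂ → Prop) : Prop :=
  ∃ P : MvPolynomial (Fin n × Fin n) ℂ, P ≠ 0 ∧
    ∀ g : GL (Fin n) ℂ, eval (fun e => g e.1 e.2) P ≠ 0 → p g

theorem Generically.mono {n : ℕ} {p q : GL (Fin n) ℂ → Prop} (hp : Generically p)
    (h : ∀ g, p g → q g) : Generically q :=
  let ⟨P, hP, hp⟩ := hp
  ⟨P, hP, fun g hg => h g (hp g hg)⟩

theorem Generically.and {n : ℕ} {p q : GL (Fin n) ℂ → Prop} (hp : Generically p)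
    (hq : Generically q) : Generically fun g => p g ∧ q g := by
  obtain ⟨P, hP, hp⟩ := hp
  obtain ⟨Q, hQ, hq⟩ := hq
  refine ⟨P * Q, mul_ne_zero hP hQ, fun g hg => ?_⟩
  rw [map_mul] at hg
  exact ⟨hp g (left_ne_zero_of_mul hg), hq g (right_ne_zero_of_mul hg)⟩

/-- What holds generically holds somewhere. -/
theorem Generically.exists {n : ℕ} {p : GL (Fin n) ℂ → Prop} (hp : Generically p) :
    ∃ g, p g := by
  obtain ⟨P, hP, hp⟩ := hp
  have hne : P * (Matrix.mvPolynomialX (Fin n) (Fin n) ℂ).det ≠ 0 :=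
    mul_ne_zero hP (Matrix.det_mvPolynomialX_ne_zero (Fin n) ℂ)
  have hex : ∃ v : Fin n × Fin n → ℂ,
      eval v (P * (Matrix.mvPolynomialX (Fin n) (Fin n) ℂ).det) ≠ 0 := by
    by_contra! hall
    exact hne (MvPolynomial.funext fun v => by rw [hall v, map_zero])
  obtain ⟨v, hv⟩ := hex
  rw [map_mul] at hv
  let A : Matrix (Fin n) (Fin n) ℂ := Matrix.of fun i j => v (i, j)
  have hdet : A.det = eval v (Matrix.mvPolynomialX (Fin n) (Fin n) ℂ).det := by
    rw [RingHom.map_det]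
    exact congrArg Matrix.det (Matrix.mvPolynomialX_mapMatrix_eval A).symm
  have hA : A.det ≠ 0 := by
    rw [hdet]
    exact right_ne_zero_of_mul hv
  exact ⟨Matrix.GeneralLinearGroup.mkOfDetNeZero A hA, hp _ (left_ne_zero_of_mul hv)⟩

/-- The generic initial ideal `gin(I)`: it consists of the polynomials that lie in `in(g · I)`
for generic `g`. This is the generic value of `in(g · I)` (see `gin_eq`). -/
noncomputable def gin {n : ℕ} (I : Ideal (MvPolynomial (Fin n) ℂ)) :
    Ideal (MvPolynomial (Fin n) ℂ) where
  carrier := {f | Generically fun g => f ∈ initialIdeal (changeCoords g I)}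
  zero_mem' := ⟨1, one_ne_zero, fun _ _ => Ideal.zero_mem _⟩
  add_mem' hf hh := (Generically.and hf hh).mono fun _ h => Ideal.add_mem _ h.1 h.2
  smul_mem' c _ hf := Generically.mono hf fun _ h => Ideal.mul_mem_left _ c h

/-- If `in(g · I)` equals a fixed ideal `G` for all `g` in a nonempty Zariski open subset of
`GLₙ(ℂ)`, then `gin(I) = G`. -/
theorem gin_eq {n : ℕ} {I G : Ideal (MvPolynomial (Fin n) ℂ)}
    (h : Generically fun g => initialIdeal (changeCoords g I) = G) : gin I = G := by
  ext f
  constructor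
  · intro hf
    have hf' : Generically fun g => f ∈ initialIdeal (changeCoords g I) := hf
    obtain ⟨g, hg, hg'⟩ := (h.and hf').exists
    exact hg ▸ hg'
  · intro hf
    exact h.mono fun g hg => hg ▸ hf

/-!
Let `h` be a common divisor of `K ≠ 0` of the largest possible degree `d`. It is homogeneous, since
it divides a nonzero homogeneous element of `K`, and `K = h · J`, where `J` is a homogeneous ideal
whose only common divisors are units. Then `g · K = (g · h)(g · J)`, and for generic `g` the leading
monomial of `g · h` is `x₁ ^ d`: the coefficient of `x₁ ^ d` in `g · h` is the value of `h` at the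
first column of `g`. So all that is to be shown is `d = k`. Since every element of `g · K` is a
multiple of `g · h`, we have `gin(K) ⊆ (x₁ ^ d)`, that is, `d ≤ k`. For `k ≤ d` it is enough that
`x₁ ^ d x₂ ^ N x₃ ^ N ∈ gin(K)` for some `N`, and this follows when **every** `g · J` contains a
nonzero polynomial in `x₂, x₃` alone, with both exponents at most `N`
(`exists_mem_changeCoords_ne_zero`).

To find `N`, work with `J` in the original coordinates. By Gauss's lemma, an ideal without nonunit
common divisors contains, for each variable `xᵢ`, a nonzero polynomial free of `xᵢ`
(`MvPolynomial.exists_mem_forall_support_apply_eq_zero`). A monomial that is divisible by none of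
the three leading monomials has two of its three exponents bounded, so there are only `O(N)` such
monomials of degree at most `N`, and by division they span the image of the polynomials of degree at
most `N` in `ℂ[x₁, x₂, x₃] / J`. A linear change of coordinates preserves the degree, so the
`(n + 1)²` monomials `x₂ ^ i x₃ ^ j` with `i, j ≤ n`, pulled back along `g`, are linearly dependent modulo `J`
as soon as `n` is large, and how large does not depend on `g`.
-/

/-! ### Elimination of a variable -/

/-- An ideal of `R[t]` without nonunit common divisors contains a nonzero constant: over the
fraction field it is generated by one polynomial, and by Gauss's lemma the primitive integral
multiple of this generator is a common divisor. -/
theorem Polynomial.exists_C_mem_of_forall_dvd {R : Type*} [CommRing R] [IsDomain R]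
    [UniqueFactorizationMonoid R] {J : Ideal (Polynomial R)} (hJ : J ≠ ⊥)
    (h : ∀ p, (∀ q ∈ J, p ∣ q) → IsUnit p) : ∃ r : R, r ≠ 0 ∧ Polynomial.C r ∈ J := by
  classical
  let : NormalizedGCDMonoid R := Nonempty.some inferInstance
  let F := FractionRing R
  let : Algebra (Polynomial R) (Polynomial F) := Polynomial.algebra _ _
  have : IsLocalization ((nonZeroDivisors R).map (Polynomial.C : R →+* Polynomial R))
    (Polynomial F) := Polynomial.isLocalization _ _
  obtain ⟨p, hp⟩ := (IsPrincipalIdealRing.principal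
    (J.map (algebraMap (Polynomial R) (Polynomial F)))).principal
  have hdvd : ∀ q ∈ J, p ∣ q.map (algebraMap R F) := fun q hq => by
    have := Ideal.mem_map_of_mem (algebraMap (Polynomial R) (Polynomial F)) hq
    rw [hp] at this
    exact Ideal.mem_span_singleton.mp this
  have hp0 : p ≠ 0 := by
    rintro rfl
    refine hJ ((Submodule.eq_bot_iff _).mpr fun q hq => ?_)
    exact (Polynomial.map_eq_zero_iff (IsFractionRing.injective R F)).mp
      (zero_dvd_iff.mp (hdvd q hq))
  -- `n` is an integral multiple of the generator `p`
  set n := IsLocalization.integerNormalization (nonZeroDivisors R) p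
  obtain ⟨c, hc0, hc⟩ := IsLocalization.integerNormalization_spec (nonZeroDivisors R) p
  have hnp : n.primPart.map (algebraMap R F) ∣ p := by
    have h1 : n.primPart.map (algebraMap R F) ∣ n.map (algebraMap R F) :=
      Polynomial.map_dvd _ n.primPart_dvd
    have h2 : Associated (n.map (algebraMap R F)) p := by
      have hu : IsUnit (Polynomial.C (algebraMap R F c)) :=
        Polynomial.isUnit_C.mpr (isUnit_iff_ne_zero.mpr
          (IsFractionRing.to_map_ne_zero_of_mem_nonZeroDivisors hc0))
      have : n.map (algebraMap R F) = Polynomial.C (algebraMap R F c) * p := by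
        rw [← Polynomial.smul_eq_C_mul, algebraMap_smul]
        exact hc
      rw [this]
      exact associated_unit_mul_left p _ hu
    exact h1.trans h2.dvd
  have hunit : IsUnit p :=
    Polynomial.isUnit_or_eq_zero_of_isUnit_integerNormalization_primPart hp0
      (h _ fun q hq => n.isPrimitive_primPart.dvd_of_fraction_map_dvd_fraction_map (K := F)
        (hnp.trans (hdvd q hq)))
  have h1 : algebraMap (Polynomial R) (Polynomial F) 1 ∈ J.map (algebraMap _ (Polynomial F)) := by
    rw [hp, Ideal.submodule_span_eq, Ideal.span_singleton_eq_top.mpr hunit]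
    trivial
  obtain ⟨⟨x, ⟨s, hs⟩⟩, hx⟩ := (IsLocalization.mem_map_algebraMap_iff
    ((nonZeroDivisors R).map (Polynomial.C : R →+* Polynomial R)) (Polynomial F)).mp h1
  obtain ⟨r, hr, rfl⟩ := Submonoid.mem_map.mp hs
  refine ⟨r, nonZeroDivisors.ne_zero hr, ?_⟩
  rw [← map_mul, one_mul] at hx
  have hinj : Function.Injective (algebraMap (Polynomial R) (Polynomial F)) :=
    Polynomial.map_injective _ (IsFractionRing.injective R F)
  have := hinj hx
  change Polynomial.C r = (x : Polynomial R) at this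
  rw [this]
  exact x.2

namespace MvPolynomial

theorem finSuccEquiv_rename_succ {R : Type*} [CommSemiring R] {n : ℕ} (p : MvPolynomial (Fin n) R) :
    finSuccEquiv R n (rename Fin.succ p) = Polynomial.C p := by
  induction p using MvPolynomial.induction_on with
  | C a => simp [finSuccEquiv_apply]
  | add p q hp hq => simp [hp, hq]
  | mul_X p i hp => simp [hp, finSuccEquiv_X_succ]

/-- An ideal without nonunit common divisors contains, for each variable, a nonzero polynomial in
which this variable does not occur. -/
theorem exists_mem_forall_support_apply_eq_zero {k : Type*} [Field k] {n : ℕ}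
    {J : Ideal (MvPolynomial (Fin (n + 1)) k)} (hJ : J ≠ ⊥)
    (h : ∀ p, (∀ q ∈ J, p ∣ q) → IsUnit p) (i : Fin (n + 1)) :
    ∃ D ∈ J, D ≠ 0 ∧ ∀ m ∈ D.support, m i = 0 := by
  -- moves the variable `i` to the place of `0` and splits it off
  let e := (renameEquiv k (Equiv.swap 0 i)).trans (finSuccEquiv k n)
  have hmem : ∀ q, q ∈ J.comap e.symm ↔ e.symm q ∈ J := fun q => Iff.rfl
  obtain ⟨r, hr, hrJ⟩ := Polynomial.exists_C_mem_of_forall_dvd (J := J.comap e.symm)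
    (by
      obtain ⟨q, hq, hq0⟩ := Submodule.exists_mem_ne_zero_of_ne_bot hJ
      exact (Submodule.ne_bot_iff _).mpr
        ⟨e q, (hmem _).mpr (by simpa using hq), by simpa using hq0⟩)
    (fun p hp => by
      have := h (e.symm p) fun q hq => by
        have := map_dvd e.symm (hp (e q) ((hmem _).mpr (by simpa using hq)))
        simpa using this
      simpa using this)
  refine ⟨e.symm (Polynomial.C r), (hmem _).mp hrJ, by simpa using hr, ?_⟩
  have hD : e.symm (Polynomial.C r) = rename (Equiv.swap 0 i ∘ Fin.succ) r := by
    rw [AlgEquiv.symm_apply_eq]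
    simp only [e, AlgEquiv.trans_apply, renameEquiv_apply, rename_rename]
    have : (Equiv.swap 0 i : Fin (n+1) → _) ∘ Equiv.swap 0 i ∘ Fin.succ = Fin.succ := by
      ext; simp
    rw [this, finSuccEquiv_rename_succ]
  intro m hm
  classical
  rw [hD, support_rename_of_injective ((Equiv.injective _).comp (Fin.succ_injective n))] at hm
  obtain ⟨u, -, rfl⟩ := Finset.mem_image.mp hm
  refine Finsupp.mapDomain_of_notMem_range _ _ ?_
  rintro ⟨j, hj⟩
  have : Fin.succ j = 0 := (Equiv.swap (0 : Fin (n+1)) i).injective (by simpa using hj)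
  exact Fin.succ_ne_zero j this

/-! ### Divisors of homogeneous polynomials -/

section Scaling

variable {σ R : Type*} [CommRing R]

/-- The substitution `x_i ↦ x_i t`, whose value at `p` is the polynomial in `t` with the homogeneous
components of `p` as coefficients. -/
noncomputable def scaleVars : MvPolynomial σ R →+* Polynomial (MvPolynomial σ R) :=
  eval₂Hom (Polynomial.C.comp C) fun i => Polynomial.C (X i) * Polynomial.X

theorem scaleVars_monomial (m : σ →₀ ℕ) (c : R) :
    scaleVars (monomial m c) = Polynomial.monomial m.degree (monomial m c) := by
  have h1 : m.prod (fun i e => (Polynomial.C (X i : MvPolynomial σ R) * Polynomial.X) ^ e)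
      = Polynomial.C (m.prod fun i e => X i ^ e) * Polynomial.X ^ m.degree := by
    rw [Finsupp.prod, Finsupp.prod, Finsupp.degree_apply, ← Finset.prod_pow_eq_pow_sum, map_prod,
      ← Finset.prod_mul_distrib]
    exact Finset.prod_congr rfl fun i _ => by rw [mul_pow, map_pow]
  rw [← Polynomial.C_mul_X_pow_eq_monomial, scaleVars, coe_eval₂Hom, eval₂_monomial, h1,
    monomial_eq, RingHom.comp_apply, map_mul, mul_assoc]

theorem coeff_coeff_scaleVars (p : MvPolynomial σ R) (m : σ →₀ ℕ) (j : ℕ) :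
    coeff m ((scaleVars p).coeff j) = if m.degree = j then coeff m p else 0 := by
  classical
  induction p using MvPolynomial.induction_on' with
  | monomial u c =>
    rw [scaleVars_monomial, Polynomial.coeff_monomial]
    split_ifs <;> simp_all [coeff_monomial] <;> grind
  | add p q hp hq =>
    rw [map_add, Polynomial.coeff_add, coeff_add, hp, hq, coeff_add]
    split_ifs <;> simp

/-- A divisor of a nonzero homogeneous polynomial is homogeneous: a divisor of a monomial in `t`
has equal degree and trailing degree in `t`. -/
theorem IsHomogeneous.exists_of_mul [IsDomain R] {p q : MvPolynomial σ R}
    {n : ℕ} (h : (p * q).IsHomogeneous n) (h0 : p * q ≠ 0) : ∃ d, p.IsHomogeneous d := by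
  have hpq : scaleVars (p * q) = Polynomial.monomial n (p * q) := by
    ext j m
    rw [coeff_coeff_scaleVars, Polynomial.coeff_monomial]
    by_cases hm : coeff m (p * q) = 0
    · split_ifs <;> simp [hm]
    · have := h hm
      rw [Pi.one_def, ← Finsupp.degree_eq_weight_one] at this
      simp only [this]
      split_ifs <;> simp
  have hmul : scaleVars p * scaleVars q = Polynomial.monomial n (p * q) := by rw [← hpq, map_mul]
  have hne : scaleVars p * scaleVars q ≠ 0 := by
    rw [hmul]
    simpa using h0
  have h1 := Polynomial.natDegree_mul (left_ne_zero_of_mul hne) (right_ne_zero_of_mul hne)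
  have h2 := Polynomial.natTrailingDegree_mul (left_ne_zero_of_mul hne) (right_ne_zero_of_mul hne)
  rw [hmul, Polynomial.natDegree_monomial_eq _ h0] at h1
  rw [hmul, Polynomial.natTrailingDegree_monomial h0] at h2
  have h3 := (scaleVars p).natTrailingDegree_le_natDegree
  have h4 := (scaleVars q).natTrailingDegree_le_natDegree
  refine ⟨(scaleVars p).natDegree, fun {m} hm => ?_⟩
  rw [Pi.one_def, ← Finsupp.degree_eq_weight_one]
  have hc : (scaleVars p).coeff m.degree ≠ 0 := fun h0 => hm (by
    have := coeff_coeff_scaleVars p m m.degree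
    rwa [h0, if_pos rfl, coeff_zero, eq_comm] at this)
  have h5 := Polynomial.le_natDegree_of_ne_zero hc
  have h6 := Polynomial.natTrailingDegree_le_of_ne_zero hc
  omega

end Scaling

end MvPolynomial

/-! ### Splitting off the greatest common divisor of a homogeneous ideal -/

namespace MvPolynomial
variable {σ k : Type*} [Field k]

/-- A nonzero homogeneous ideal is a homogeneous polynomial times a homogeneous ideal without
nonunit common divisors. -/
theorem exists_eq_span_mul_of_isHomogeneous {K : Ideal (MvPolynomial σ k)} (hK0 : K ≠ ⊥)
    (hK : K.IsHomogeneous (homogeneousSubmodule σ k)) :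
    ∃ (h : MvPolynomial σ k) (d : ℕ) (K' : Ideal (MvPolynomial σ k)), h ≠ 0 ∧ h.IsHomogeneous d ∧
      K'.IsHomogeneous (homogeneousSubmodule σ k) ∧ K' ≠ ⊥ ∧ K = Ideal.span {h} * K' ∧
      ∀ p, (∀ q ∈ K', p ∣ q) → IsUnit p := by
  obtain ⟨f, hf, hf0⟩ := Submodule.exists_mem_ne_zero_of_ne_bot hK0
  -- a common divisor of the ideal of the largest possible degree
  obtain ⟨h, hh, hmax⟩ : ∃ h, (∀ q ∈ K, h ∣ q) ∧
      ∀ h', (∀ q ∈ K, h' ∣ q) → h'.totalDegree ≤ h.totalDegree := by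
    let s : Set ℕ := totalDegree '' {h : MvPolynomial σ k | ∀ q ∈ K, h ∣ q}
    have hb : BddAbove s := ⟨f.totalDegree, by
      rintro _ ⟨h, hh, rfl⟩
      exact totalDegree_le_of_dvd_of_isDomain (hh f hf) hf0⟩
    obtain ⟨h, hh, hs⟩ := Nat.sSup_mem (s := s) ⟨_, 1, fun q _ => one_dvd q, rfl⟩ hb
    exact ⟨h, hh, fun h' hh' => hs ▸ le_csSup hb ⟨h', hh', rfl⟩⟩
  have hh0 : h ≠ 0 := fun h0 => hf0 (zero_dvd_iff.mp (h0 ▸ hh f hf))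
  obtain ⟨d, hd⟩ : ∃ d, h.IsHomogeneous d := by
    obtain ⟨j, hj⟩ : ∃ j, homogeneousComponent j f ≠ 0 := by
      by_contra! hall
      rw [← sum_homogeneousComponent f, Finset.sum_eq_zero fun j _ => hall j] at hf0
      exact hf0 rfl
    obtain ⟨q, hq⟩ := hh _ (homogeneousComponent_mem_of_mem hK hf j)
    have hfj : (h * q).IsHomogeneous j := hq ▸ homogeneousComponent_isHomogeneous j f
    exact hfj.exists_of_mul (hq ▸ hj)
  let K' : Ideal (MvPolynomial σ k) := Submodule.comap (LinearMap.mulLeft (MvPolynomial σ k) h) K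
  have hK' : ∀ q, q ∈ K' ↔ h * q ∈ K := fun q => Iff.rfl
  have hKK : K = Ideal.span {h} * K' := by
    ext q
    rw [Ideal.mem_span_singleton_mul]
    constructor
    · intro hq
      obtain ⟨r, rfl⟩ := hh q hq
      exact ⟨r, hq, rfl⟩
    · rintro ⟨r, hr, rfl⟩
      exact hr
  refine ⟨h, d, K', hh0, hd, fun i q hq => ?_, ?_, hKK, fun p hp => ?_⟩
  · rw [hK', ← DirectSum.coe_decompose_mul_add_of_left_mem (homogeneousSubmodule σ k) hd]
    exact hK _ hq
  · rintro h0
    rw [h0, Ideal.mul_bot] at hKK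
    exact hK0 hKK
  · have hdvd : ∀ q ∈ K, h * p ∣ q := fun q hq => by
      obtain ⟨r, rfl⟩ := hh q hq
      exact mul_dvd_mul_left h (hp r hq)
    have hp0 : p ≠ 0 := by
      rintro rfl
      exact hf0 (zero_dvd_iff.mp (by simpa using hdvd f hf))
    have h1 := hmax _ hdvd
    rw [totalDegree_mul_of_isDomain hh0 hp0] at h1
    have h2 : p.totalDegree = 0 := by omega
    rw [totalDegree_eq_zero_iff_eq_C] at h2
    rw [h2] at hp0 ⊢
    exact (isUnit_iff_ne_zero.mpr fun h0 => hp0 (by rw [h0, map_zero])).map C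
end MvPolynomial

/-! ### Linear changes of coordinates -/

theorem coordChange_comp {n : ℕ} (g g' : GL (Fin n) ℂ) (p : MvPolynomial (Fin n) ℂ) :
    coordChange g (coordChange g' p) = coordChange (g' * g) p := by
  suffices (coordChange g).comp (coordChange g') = coordChange (g' * g) from
    DFunLike.congr_fun this p
  refine MvPolynomial.algHom_ext fun i => ?_
  simp only [coordChange, AlgHom.comp_apply, aeval_X, map_sum, map_mul, Units.val_mul,
    Matrix.mul_apply, algHom_C, algebraMap_eq, Finset.mul_sum, Finset.sum_mul]
  rw [Finset.sum_comm]
  simp only [mul_assoc]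

theorem coordChange_one {n : ℕ} (p : MvPolynomial (Fin n) ℂ) : coordChange 1 p = p := by
  have : coordChange (1 : GL (Fin n) ℂ) = AlgHom.id ℂ _ := by
    ext i : 1
    simp [coordChange, Matrix.one_apply]
  rw [this, AlgHom.id_apply]

theorem coordChange_coordChange_inv {n : ℕ} (g : GL (Fin n) ℂ) (p : MvPolynomial (Fin n) ℂ) :
    coordChange g (coordChange g⁻¹ p) = p := by
  rw [coordChange_comp, inv_mul_cancel, coordChange_one]

theorem isHomogeneous_coordChange {n : ℕ} (g : GL (Fin n) ℂ) {p : MvPolynomial (Fin n) ℂ} {d : ℕ}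
    (hp : p.IsHomogeneous d) : (coordChange g p).IsHomogeneous d := by
  have := hp.aeval (fun i => ∑ j, C (g i j) * X j) (n := 1) fun i =>
    IsHomogeneous.sum _ _ _ fun j _ => isHomogeneous_C_mul_X (g i j) j
  rwa [one_mul] at this

theorem isHomogeneous_changeCoords {n : ℕ} (g : GL (Fin n) ℂ) {I : Ideal (MvPolynomial (Fin n) ℂ)}
    (hI : I.IsHomogeneous (homogeneousSubmodule (Fin n) ℂ)) :
    (changeCoords g I).IsHomogeneous (homogeneousSubmodule (Fin n) ℂ) := by
  obtain ⟨s, rfl⟩ := (Ideal.IsHomogeneous.iff_exists _ _).mp hI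
  rw [changeCoords, Ideal.map_span]
  refine Ideal.homogeneous_span _ _ ?_
  rintro _ ⟨_, ⟨x, -, rfl⟩, rfl⟩
  obtain ⟨d, hd⟩ := x.2
  exact ⟨d, isHomogeneous_coordChange g hd⟩

theorem changeCoords_span_mul {n : ℕ} (g : GL (Fin n) ℂ) (h : MvPolynomial (Fin n) ℂ)
    (I : Ideal (MvPolynomial (Fin n) ℂ)) :
    changeCoords g (Ideal.span {h} * I) = Ideal.span {coordChange g h} * changeCoords g I := by
  simp only [changeCoords, Ideal.map_mul, Ideal.map_span, Set.image_singleton]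

theorem eval_single_coordChange (g : GL (Fin 3) ℂ) (p : MvPolynomial (Fin 3) ℂ) :
    eval (Pi.single 0 1) (coordChange g p) = eval (fun i => g i 0) p := by
  suffices (eval (Pi.single 0 1)).comp (coordChange g).toRingHom
      = eval fun i => g i 0 from DFunLike.congr_fun this p
  refine MvPolynomial.ringHom_ext (fun r => ?_) fun i => ?_
  · simp [coordChange]
  · simp [coordChange, Pi.single_apply]

theorem MvPolynomial.IsHomogeneous.eval_single {σ R : Type*} [CommSemiring R] [DecidableEq σ]
    {p : MvPolynomial σ R} {d : ℕ}
    (hp : p.IsHomogeneous d) (i : σ) : eval (Pi.single i 1) p = coeff (Finsupp.single i d) p := by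
  rw [eval_eq, Finset.sum_eq_single (Finsupp.single i d)]
  · rw [Finset.prod_eq_one, mul_one]
    intro j hj
    have := Finsupp.support_single_subset hj
    rw [Finset.mem_singleton.mp this, Pi.single_eq_same, one_pow]
  · intro m hm hmi
    obtain ⟨j, hj, hji⟩ : ∃ j ∈ m.support, j ≠ i := by
      by_contra! hall
      have h1 : m = Finsupp.single i (m i) := by
        rw [← Finsupp.support_subset_singleton]
        exact fun j hj => Finset.mem_singleton.mpr (hall j hj)
      have h2 := hp.degree_eq_sum_deg_support hm
      rw [h1, ← Finsupp.degree_apply, Finsupp.degree_single] at h2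
      exact hmi (h2 ▸ h1)
    rw [Finset.prod_eq_zero hj, mul_zero]
    rw [Pi.single_eq_of_ne hji, zero_pow (Finsupp.mem_support_iff.mp hj)]
  · intro h
    rw [notMem_support_iff.mp h, zero_mul]

/-! ### Counting standard monomials -/

/-- If the `i`-th of three monomials does not involve the `i`-th variable, then the number of
monomials of degree at most `N` divisible by none of the three grows at most linearly in `N`. -/
theorem exists_card_standard_le (a : Fin 3 → (Fin 3 →₀ ℕ)) (ha : ∀ i, a i i = 0) :
    ∃ c, ∀ N, ∃ T : Finset (Fin 3 →₀ ℕ), T.card ≤ c * (N + 1) ∧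
      ∀ m : Fin 3 →₀ ℕ, m.degree ≤ N → (∀ i, ¬ a i ≤ m) → m ∈ T := by
  let M := ∑ i, ∑ j, a i j
  have hM : ∀ i j, a i j ≤ M := fun i j =>
    (Finset.single_le_sum (fun j _ => Nat.zero_le (a i j)) (Finset.mem_univ j)).trans
      (Finset.single_le_sum (f := fun i => ∑ j, a i j) (fun i _ => Nat.zero_le _)
        (Finset.mem_univ i))
  -- two of the exponents are less than `M`, the third, that of the variable `t.1`, is at most `N`
  refine ⟨3 * (M * M), fun N => ⟨(Finset.univ ×ˢ ((Finset.range M ×ˢ Finset.range M) ×ˢ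
    Finset.range (N + 1))).image fun t : Fin 3 × (ℕ × ℕ) × ℕ => Finsupp.single t.1 t.2.2 +
      Finsupp.single (t.1 + 1) t.2.1.1 + Finsupp.single (t.1 + 2) t.2.1.2, ?_, ?_⟩⟩
  · refine Finset.card_image_le.trans (le_of_eq ?_)
    simp [mul_assoc]
  · intro m hm hma
    have h : ∀ i : Fin 3, m (i + 1) < M ∨ m (i + 2) < M := fun i => by
      obtain ⟨j, hj⟩ : ∃ j, m j < a i j := by
        by_contra! hall
        exact hma i hall
      have hji : j ≠ i := by
        rintro rfl
        rw [ha] at hj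
        omega
      have hj' := hj.trans_le (hM i j)
      have : j = i + 1 ∨ j = i + 2 := by
        clear * - hji
        decide +revert
      rcases this with rfl | rfl
      exacts [Or.inl hj', Or.inr hj']
    obtain ⟨i, h1, h2⟩ : ∃ i : Fin 3, m (i + 1) < M ∧ m (i + 2) < M := by
      have h0 := h 0
      have h1 := h 1
      have h2 := h 2
      simp only [Fin.isValue, Fin.reduceAdd] at h0 h1 h2
      by_cases hm0 : m 0 < M
      · by_cases hm1 : m 1 < M
        · exact ⟨2, hm0, hm1⟩
        · exact ⟨1, (h0.resolve_left hm1), hm0⟩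
      · exact ⟨0, h2.resolve_left hm0, h1.resolve_right hm0⟩
    refine Finset.mem_image.mpr ⟨(i, (m (i + 1), m (i + 2)), m i), ?_, ?_⟩
    · simp only [Finset.mem_product, Finset.mem_univ, Finset.mem_range, true_and]
      have := Finsupp.le_degree i m
      omega
    · ext j
      fin_cases i <;> fin_cases j <;> simp

theorem degree_le_of_toSyn_le {n : ℕ} {a b : Fin n →₀ ℕ}
    (h : (degRevLex n).toSyn a ≤ (degRevLex n).toSyn b) : a.degree ≤ b.degree := by
  rcases h.eq_or_lt with h | h
  · rw [(degRevLex n).toSyn.injective h]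
  · rcases degRevLex_lt_iff.mp h with h | h
    · exact h.le
    · exact h.1.le

theorem degree_degree_le_totalDegree {n : ℕ} (f : MvPolynomial (Fin n) ℂ) :
    ((degRevLex n).degree f).degree ≤ f.totalDegree := by
  by_cases hf : f = 0
  · simp [hf, MonomialOrder.degree_zero]
  · exact le_totalDegree ((degRevLex n).degree_mem_support hf)

/-- Division by nonzero elements `D i` of an ideal: modulo the ideal, every polynomial agrees with a
combination of monomials of no larger total degree that are divisible by none of the leading
monomials of the `D i`. -/
theorem exists_sub_mem_of_standard {n : ℕ} {ι : Type*} {J : Ideal (MvPolynomial (Fin n) ℂ)}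
    {D : ι → MvPolynomial (Fin n) ℂ} (hDJ : ∀ i, D i ∈ J) (hD : ∀ i, D i ≠ 0)
    (f : MvPolynomial (Fin n) ℂ) :
    ∃ r, f - r ∈ J ∧ ∀ m ∈ r.support, m.degree ≤ f.totalDegree ∧
      ∀ i, ¬ (degRevLex n).degree (D i) ≤ m := by
  obtain ⟨q, r, hf, hq, hr⟩ := (degRevLex n).div (b := D)
    (fun i => isUnit_iff_ne_zero.mpr ((degRevLex n).leadingCoeff_ne_zero_iff.mpr (hD i))) f
  have hfr : f - r = ∑ i ∈ q.support, D i * q i := by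
    rw [hf, add_sub_cancel_right, Finsupp.linearCombination_apply, Finsupp.sum]
    exact Finset.sum_congr rfl fun i _ => mul_comm _ _
  refine ⟨r, ?_, fun m hm => ⟨?_, hr m hm⟩⟩
  · rw [hfr]
    exact J.sum_mem fun i _ => J.mul_mem_right _ (hDJ i)
  · have h1 : (degRevLex n).toSyn ((degRevLex n).degree r) ≤
        (degRevLex n).toSyn ((degRevLex n).degree f) := by
      have : r = f - ∑ i ∈ q.support, D i * q i := by rw [← hfr, sub_sub_cancel]
      rw [this]
      refine (degRevLex n).degree_sub_le.trans (sup_le le_rfl ?_)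
      refine (degRevLex n).degree_sum_le.trans (Finset.sup_le fun i _ => hq i)
    exact (degree_le_of_toSyn_le (((degRevLex n).le_degree hm).trans h1)).trans
      (degree_degree_le_totalDegree f)

/-- If an ideal `J ≠ 0` has no nonunit common divisors, then in all coordinates it contains a
nonzero polynomial in the last two variables, with a bound on the exponents that does not depend on the
coordinates. -/
theorem exists_mem_changeCoords_ne_zero {J : Ideal (MvPolynomial (Fin 3) ℂ)} (hJ : J ≠ ⊥)
    (h : ∀ p, (∀ q ∈ J, p ∣ q) → IsUnit p) :
    ∃ N, ∀ g : GL (Fin 3) ℂ, ∃ p ∈ changeCoords g J, p ≠ 0 ∧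
      ∀ m ∈ p.support, m 0 = 0 ∧ m 1 ≤ N ∧ m 2 ≤ N := by
  choose D hDJ hD0 hD using exists_mem_forall_support_apply_eq_zero hJ h
  obtain ⟨c, hc⟩ := exists_card_standard_le (fun i => (degRevLex 3).degree (D i))
    fun i => hD i _ ((degRevLex 3).degree_mem_support (hD0 i))
  -- `x₂ ^ i x₃ ^ j` with `i, j ≤ 2c` has degree at most `4c`, and `c (4c + 1) < (2c + 1)²`
  refine ⟨2 * c, fun g => ?_⟩
  obtain ⟨T, hTc, hT⟩ := hc (4 * c)
  let mk : MvPolynomial (Fin 3) ℂ →ₗ[ℂ] MvPolynomial (Fin 3) ℂ ⧸ J :=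
    (Ideal.Quotient.mkₐ ℂ J).toLinearMap
  have hmk : ∀ f, mk f = 0 ↔ f ∈ J := fun f => Ideal.Quotient.eq_zero_iff_mem
  have hspan : ∀ f : MvPolynomial (Fin 3) ℂ, f.totalDegree ≤ 4 * c →
      mk f ∈ Submodule.span ℂ ((fun m => mk (monomial m 1)) '' (T : Set (Fin 3 →₀ ℕ))) := by
    intro f hf
    obtain ⟨r, hr, hrT⟩ := exists_sub_mem_of_standard hDJ hD0 f
    rw [← hmk, map_sub, sub_eq_zero] at hr
    rw [hr, r.as_sum, map_sum]
    refine Submodule.sum_mem _ fun m hm => ?_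
    have : monomial m (coeff m r) = coeff m r • monomial m (1 : ℂ) := by
      rw [smul_monomial, smul_eq_mul, mul_one]
    rw [this, map_smul]
    refine Submodule.smul_mem _ _ (Submodule.subset_span ⟨m, ?_, rfl⟩)
    exact hT m ((hrT m hm).1.trans hf) (hrT m hm).2
  let e : Fin (2 * c + 1) × Fin (2 * c + 1) → Fin 3 →₀ ℕ := fun t =>
    Finsupp.single 1 t.1.val + Finsupp.single 2 t.2.val
  have he0 : ∀ t, e t 0 = 0 := fun t => by simp [e]
  have he1 : ∀ t, e t 1 = t.1.val := fun t => by simp [e]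
  have he2 : ∀ t, e t 2 = t.2.val := fun t => by simp [e]
  have he : Function.Injective e := fun t t' htt => by
    refine Prod.ext (Fin.ext ?_) (Fin.ext ?_)
    · rw [← he1, ← he1, htt]
    · rw [← he2, ← he2, htt]
  let v : Fin (2 * c + 1) × Fin (2 * c + 1) → MvPolynomial (Fin 3) ℂ ⧸ J := fun t =>
    mk (coordChange g⁻¹ (monomial (e t) 1))
  have hdep : ¬ LinearIndependent ℂ v := by
    classical
    intro hv
    rw [linearIndependent_iff_card_le_finrank_span] at hv
    have hle : Submodule.span ℂ (Set.range v) ≤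
        Submodule.span ℂ ((T.image fun m => mk (monomial m 1) : Finset _) : Set _) := by
      rw [Submodule.span_le, Finset.coe_image]
      rintro _ ⟨t, rfl⟩
      refine hspan _ ((isHomogeneous_coordChange g⁻¹
        (isHomogeneous_monomial 1 rfl)).totalDegree_le.trans ?_)
      rw [Finsupp.degree_eq_sum, Fin.sum_univ_three, he0, he1, he2]
      have := t.1.isLt
      have := t.2.isLt
      omega
    have h1 := hv.trans ((Submodule.finrank_mono hle).trans
      ((finrank_span_finset_le_card _).trans Finset.card_image_le))
    rw [Fintype.card_prod, Fintype.card_fin] at h1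
    nlinarith
  obtain ⟨w, hw, t, ht⟩ := Fintype.not_linearIndependent_iff.mp hdep
  let p : MvPolynomial (Fin 3) ℂ := ∑ t, monomial (e t) (w t)
  have hp : ∀ t, coeff (e t) p = w t := fun t => by
    classical
    simp [p, coeff_sum, coeff_monomial, he.eq_iff]
  refine ⟨p, ?_, ?_, ?_⟩
  · have : coordChange g⁻¹ p ∈ J := by
      rw [← hmk, ← hw, map_sum, map_sum]
      refine Finset.sum_congr rfl fun t _ => ?_
      rw [← map_smul, ← map_smul, smul_monomial, smul_eq_mul, mul_one]
    rw [← coordChange_coordChange_inv g p]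
    exact Ideal.mem_map_of_mem _ this
  · intro h0
    apply ht
    rw [← hp, h0, coeff_zero]
  · intro m hm
    classical
    obtain ⟨t, -, htm⟩ := Finset.mem_biUnion.mp (support_sum hm)
    rw [Finset.mem_singleton.mp (support_monomial_subset htm), he0, he1, he2]
    have := t.1.isLt
    have := t.2.isLt
    omega

/-! ### Leading terms in generic coordinates -/

theorem gin_bot {n : ℕ} : gin (⊥ : Ideal (MvPolynomial (Fin n) ℂ)) = ⊥ := by
  refine gin_eq ⟨1, one_ne_zero, fun g _ => ?_⟩
  simp [changeCoords, Ideal.map_bot, initialIdeal]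

/-- `x₁ ^ d` is the largest monomial of degree `d`. -/
theorem degree_eq_single_zero {f : MvPolynomial (Fin 3) ℂ} {d : ℕ} (hf : f.IsHomogeneous d)
    (hc : coeff (Finsupp.single 0 d) f ≠ 0) : (degRevLex 3).degree f = Finsupp.single 0 d := by
  have hle := (degRevLex 3).le_degree (mem_support_iff.mpr hc)
  refine (degRevLex 3).toSyn.injective (le_antisymm ?_ hle)
  by_contra! hlt
  have hf0 : f ≠ 0 := by
    rintro rfl
    simp at hc
  have hdeg : ((degRevLex 3).degree f).degree = d :=
    (hf.degree_eq_sum_deg_support ((degRevLex 3).degree_mem_support hf0)).symm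
  rcases degRevLex_lt_iff.mp hlt with h | ⟨h, i, hi, hlt⟩
  · rw [hdeg, Finsupp.degree_single] at h
    omega
  · have hi0 : i = 0 := by
      by_contra h0
      rw [Finsupp.single_apply, if_neg (Ne.symm h0)] at hlt
      omega
    subst hi0
    rw [Finsupp.degree_eq_sum, Finsupp.degree_eq_sum, Fin.sum_univ_three, Fin.sum_univ_three,
      hi 1 (by decide), hi 2 (by decide)] at h
    omega

/-- In generic coordinates the leading monomial of a form of degree `d` is `x₁ ^ d`: the coefficient
of `x₁ ^ d` is the value of the form at the first column of the matrix. -/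
theorem generically_degree_coordChange {h : MvPolynomial (Fin 3) ℂ} (h0 : h ≠ 0) {d : ℕ}
    (hd : h.IsHomogeneous d) :
    Generically fun g : GL (Fin 3) ℂ => coordChange g h ≠ 0 ∧
      (degRevLex 3).degree (coordChange g h) = Finsupp.single 0 d := by
  refine ⟨rename (fun i => (i, 0)) h, fun h' => h0 ?_, fun g hg => ?_⟩
  · exact rename_injective _ (fun i j hij => congrArg Prod.fst hij) (by rw [h', map_zero])
  · rw [eval_rename] at hg
    have hc : coeff (Finsupp.single 0 d) (coordChange g h) ≠ 0 := by
      rw [← (isHomogeneous_coordChange g hd).eval_single, eval_single_coordChange]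
      exact hg
    refine ⟨fun h' => hc (by rw [h', coeff_zero]),
      degree_eq_single_zero (isHomogeneous_coordChange g hd) hc⟩

theorem monomial_mem_initialIdeal {n : ℕ} {I : Ideal (MvPolynomial (Fin n) ℂ)}
    {f : MvPolynomial (Fin n) ℂ} (hf : f ∈ I) (hf0 : f ≠ 0) {m : Fin n →₀ ℕ}
    (hm : (degRevLex n).degree f ≤ m) :
    monomial m 1 ∈ initialIdeal I := by
  have h1 : (degRevLex n).leadingTerm f ∈ initialIdeal I := Ideal.subset_span ⟨f, hf, rfl⟩
  refine Ideal.mem_of_dvd _ ?_ h1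
  rw [MonomialOrder.leadingTerm, monomial_dvd_monomial]
  refine ⟨Or.inr hm, ?_⟩
  exact (isUnit_iff_ne_zero.mpr ((degRevLex n).leadingCoeff_ne_zero_iff.mpr hf0)).dvd

theorem lemma6 (K : Ideal (MvPolynomial (Fin 3) ℂ))
    (hK : K.IsHomogeneous (homogeneousSubmodule (Fin 3) ℂ))
    (k : ℕ) (hk : 1 ≤ k)
    (hgin : IsGreatest {j : ℕ | gin K ≤ Ideal.span {(X 0 : MvPolynomial (Fin 3) ℂ) ^ j}} k) :
    Generically fun g : GL (Fin 3) ℂ =>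
      ∃ (F : MvPolynomial (Fin 3) ℂ) (K' : Ideal (MvPolynomial (Fin 3) ℂ)),
        F.IsHomogeneous k ∧
        (degRevLex 3).leadingTerm F = (X 0 : MvPolynomial (Fin 3) ℂ) ^ k ∧
        K'.IsHomogeneous (homogeneousSubmodule (Fin 3) ℂ) ∧
        changeCoords g K = Ideal.span {F} * K' := by
  -- `gin 0 = 0` lies in every `(x₁ ^ j)`, so that no largest `j` would exist
  have hK0 : K ≠ ⊥ := by
    rintro rfl
    have := hgin.2 (show k + 1 ∈ _ by rw [Set.mem_ofPred_eq, gin_bot]; exact bot_le)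
    omega
  obtain ⟨h, d, J, h0, hd, hJ, hJ0, rfl, hJu⟩ := exists_eq_span_mul_of_isHomogeneous hK0 hK
  have hlead := generically_degree_coordChange h0 hd
  have hkd : k = d := by
    apply le_antisymm
    · obtain ⟨N, hN⟩ := exists_mem_changeCoords_ne_zero hJ0 hJu
      let m : Fin 3 →₀ ℕ := Finsupp.single 0 d + Finsupp.single 1 N + Finsupp.single 2 N
      have hm : monomial m 1 ∈ gin (Ideal.span {h} * J) := hlead.mono fun g ⟨hg0, hg⟩ => by
        obtain ⟨p, hp, hp0, hpm⟩ := hN g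
        refine monomial_mem_initialIdeal (f := coordChange g h * p) ?_ (mul_ne_zero hg0 hp0) ?_
        · rw [changeCoords_span_mul]
          exact Ideal.mul_mem_mul (Ideal.mem_span_singleton_self _) hp
        · rw [MonomialOrder.degree_mul hg0 hp0, hg]
          obtain ⟨hp1, hp2, hp3⟩ := hpm _ ((degRevLex 3).degree_mem_support hp0)
          intro i
          fin_cases i <;> simp [m, *]
      have h1 := Ideal.mem_span_singleton.mp (hgin.1 hm)
      rw [X_pow_eq_monomial, monomial_dvd_monomial] at h1
      have h2 := (h1.1.resolve_left one_ne_zero) 0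
      simpa [m] using h2
    · refine hgin.2 fun f hf => ?_
      obtain ⟨g, ⟨hg0, hg⟩, hfg⟩ := (hlead.and hf).exists
      refine Ideal.span_le.mpr ?_ hfg
      rintro _ ⟨q, hq, rfl⟩
      rw [SetLike.mem_coe, changeCoords_span_mul, Ideal.mem_span_singleton_mul] at hq
      obtain ⟨r, -, rfl⟩ := hq
      rw [SetLike.mem_coe, Ideal.mem_span_singleton, MonomialOrder.leadingTerm_mul,
        X_pow_eq_monomial]
      refine Dvd.dvd.mul_right ?_ _
      rw [MonomialOrder.leadingTerm, monomial_dvd_monomial, hg]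
      exact ⟨Or.inr le_rfl, one_dvd _⟩
  subst hkd
  refine hlead.mono fun g ⟨hg0, hg⟩ => ?_
  have hc := (degRevLex 3).leadingCoeff_ne_zero_iff.mpr hg0
  set c := (degRevLex 3).leadingCoeff (coordChange g h)
  refine ⟨C c⁻¹ * coordChange g h, changeCoords g J, (isHomogeneous_coordChange g hd).C_mul _, ?_,
    isHomogeneous_changeCoords g hJ, ?_⟩
  · rw [MonomialOrder.leadingTerm_mul, MonomialOrder.leadingTerm_C, MonomialOrder.leadingTerm, hg,
      C_mul_monomial, inv_mul_cancel₀ hc, X_pow_eq_monomial]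
  · rw [changeCoords_span_mul, Ideal.span_singleton_mul_left_unit]
    exact (isUnit_iff_ne_zero.mpr (inv_ne_zero hc)).map C
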